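/- Let $d \ge 1$, let $\Omega \subset \mathbb{R}^d$ be a Lebesgue measurable set of positive and finite Lebesgue measure, and for $\lambda \in \mathbb{R}^d$ let $e_\lambda(x) = e^{2\pi i \langle \lambda, x\rangle}$. A countable system $\{(u_n, u_n^*)\} \subset X \times X^*$, where $X$ is a separable complex Banach space with dual space $X^*$, is called an unconditional Schauder frame of $X$ if for every $x \in X$ the series $\sum_n u_n^*(x) u_n$ converges unconditionally to $x$. The space $L^p(\Omega)$ consists of complex-valued functions. (i) If $1 < p < 2$, then the space $L^p(\Omega)$ does not admit any unconditional Schauder frame of exponentials, that is, of the form $\{(e_\lambda, e_\lambda^*)\}_{\lambda \in \Lambda}$, where $\Lambda \subset \mathbb{R}^d$ is any countable set and the $e_\lambda^*$ are arbitrary elements of the dual space $(L^p(\Omega))^*$. (ii) The same conclusion holds for $2 < p < \infty$, provided that $\Omega$ has nonempty interior. -/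

import Mathlib

open MeasureTheory
open scoped ENNReal

/-- A family `(u i, u' i)` of pairs of a vector and a continuous linear functional is an
unconditional Schauder frame of `X` if, for every `x`, the series `∑ i, u' i x • u i` converges
unconditionally to `x`. Mathlib's `HasSum` (convergence of the net of all finite partial sums) is
unconditional convergence. In the theorem the index set is countable (finite or infinite). -/
def IsUnconditionalSchauderFrame {ι X : Type*} [NormedAddCommGroup X] [NormedSpace ℂ X]
    (u : ι → X) (u' : ι → StrongDual ℂ X) : Prop :=
  ∀ x : X, HasSum (fun i => u' i x • u i) x

/-- The exponential function `x ↦ exp (2 π i ⟨l, x⟩)` on `ℝ^d` with frequency `l`. -/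
noncomputable def expFun {d : ℕ} (l x : EuclideanSpace ℝ (Fin d)) : ℂ :=
  Complex.exp (2 * (Real.pi : ℂ) * Complex.I * ((inner ℝ l x : ℝ) : ℂ))

theorem continuous_expFun {d : ℕ} (l : EuclideanSpace ℝ (Fin d)) : Continuous (expFun l) := by
  unfold expFun
  fun_prop

theorem norm_expFun {d : ℕ} (l x : EuclideanSpace ℝ (Fin d)) : ‖expFun l x‖ = 1 := by
  unfold expFun
  have h : 2 * (Real.pi : ℂ) * Complex.I * ((inner ℝ l x : ℝ) : ℂ)
      = ((2 * Real.pi * inner ℝ l x : ℝ) : ℂ) * Complex.I := by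
    push_cast
    ring
  rw [h, Complex.norm_exp_ofReal_mul_I]

theorem memLp_expFun {d : ℕ} {Ω : Set (EuclideanSpace ℝ (Fin d))} (hΩ : volume Ω < ∞)
    (p : ℝ≥0∞) (l : EuclideanSpace ℝ (Fin d)) : MemLp (expFun l) p (volume.restrict Ω) := by
  have : IsFiniteMeasure (volume.restrict Ω) := ⟨by simpa using hΩ⟩
  exact MemLp.of_bound (continuous_expFun l).aestronglyMeasurable 1
    (Filter.Eventually.of_forall fun x => (norm_expFun l x).le)

/-- The exponential with frequency `l`, as an element of the complex space `L^p(Ω)`, for a set `Ω`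
of finite Lebesgue measure. -/
noncomputable def expLp {d : ℕ} {Ω : Set (EuclideanSpace ℝ (Fin d))} (hΩ : volume Ω < ∞)
    (p : ℝ≥0∞) (l : EuclideanSpace ℝ (Fin d)) : Lp ℂ p (volume.restrict Ω) :=
  (memLp_expFun hΩ p l).toLp (expFun l)

/-- `L^p(Ω)` admits an unconditional Schauder frame of exponentials: there are a countable set `Λ`
of frequencies and continuous linear functionals `e' l` on `L^p(Ω)`, for `l ∈ Λ`, such that the
pairs of the exponential with frequency `l` and `e' l` form an unconditional Schauder frame. -/
def AdmitsUnconditionalExpFrame {d : ℕ} {Ω : Set (EuclideanSpace ℝ (Fin d))}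
    (hΩ : volume Ω < ∞) (p : ℝ≥0∞) [Fact (1 ≤ p)] : Prop :=
  ∃ Λ : Set (EuclideanSpace ℝ (Fin d)), Λ.Countable ∧
    ∃ e' : Λ → StrongDual ℂ (Lp ℂ p (volume.restrict Ω)),
      IsUnconditionalSchauderFrame (fun l : Λ => expLp hΩ p l) e'

open Filter Topology

/-! In an unconditional frame, multiplying the coefficients by a bounded sequence costs only a
constant (`IsUnconditionalSchauderFrame.exists_multiplier_bound`). A combination of translates `∑
a_j f(x - j v)` acts on exponentials by such a multiplier, namely the polynomial `∑ a_j z ^ j` at a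
point of the unit circle. With Rudin–Shapiro signs and `N = 2 ^ n` terms, its operator norm is
therefore `O(√N)`, wherever all the translates stay in `Ω` (`exists_eLpNorm_sum_translate_le`).

Let `D ⊆ Ω` have positive measure and disjoint translates `D + i v ⊆ Ω`, `|i| ≤ N`. Testing on the
indicator of `D` spreads it to `N` disjoint copies and gives `N ^ (1/p) ≤ C √(2N)`, impossible for
`p < 2`. Testing on a signed sum of indicators of `D - k v` stacks all copies on `D` and gives `N ^
(1 - 1/p) ≤ C √(2N)`, impossible for `p > 2`. -/

/-! ### Unconditional convergence and bounded multipliers. -/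

theorem Summable.exists_norm_sum_le {ι X : Type*} [NormedAddCommGroup X] {x : ι → X}
    (h : Summable x) : ∃ C : ℝ, ∀ S : Finset ι, ‖∑ i ∈ S, x i‖ ≤ C := by
  classical
  obtain ⟨S₀, hS₀⟩ := (cauchySeq_finset_iff_vanishing_norm.1 h.hasSum.cauchySeq) 1 one_pos
  refine ⟨∑ i ∈ S₀, ‖x i‖ + 1, fun S => ?_⟩
  rw [← Finset.sum_inter_add_sum_sdiff S S₀ x]
  refine (norm_add_le _ _).trans (add_le_add ?_ (hS₀ _ Finset.sdiff_disjoint).le)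
  exact (norm_sum_le _ _).trans
    (Finset.sum_le_sum_of_subset_of_nonneg Finset.inter_subset_right fun _ _ _ => norm_nonneg _)

theorem Finset.sum_abs_le_of_forall_subset {ι : Type*} {S : Finset ι} {r : ι → ℝ} {M : ℝ}
    (h : ∀ T ⊆ S, |∑ i ∈ T, r i| ≤ M) : ∑ i ∈ S, |r i| ≤ 2 * M := by
  classical
  have h1 := h _ (Finset.filter_subset (fun i => 0 ≤ r i) S)
  have h2 := h _ (Finset.filter_subset (fun i => ¬ 0 ≤ r i) S)
  rw [← Finset.sum_filter_add_sum_filter_not S (fun i => 0 ≤ r i)]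
  have e1 : ∑ i ∈ S with 0 ≤ r i, |r i| = ∑ i ∈ S with 0 ≤ r i, r i :=
    Finset.sum_congr rfl fun i hi => abs_of_nonneg (Finset.mem_filter.1 hi).2
  have e2 : ∑ i ∈ S with ¬ 0 ≤ r i, |r i| = -∑ i ∈ S with ¬ 0 ≤ r i, r i := by
    rw [← Finset.sum_neg_distrib]
    exact Finset.sum_congr rfl fun i hi => abs_of_neg (not_le.1 (Finset.mem_filter.1 hi).2)
  rw [e1, e2]
  linarith [le_abs_self (∑ i ∈ S with 0 ≤ r i, r i), neg_abs_le (∑ i ∈ S with ¬ 0 ≤ r i, r i)]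

theorem Finset.sum_norm_le_of_forall_subset {ι : Type*} {S : Finset ι} {z : ι → ℂ} {M : ℝ}
    (h : ∀ T ⊆ S, ‖∑ i ∈ T, z i‖ ≤ M) : ∑ i ∈ S, ‖z i‖ ≤ 4 * M := by
  have h1 : ∑ i ∈ S, |(z i).re| ≤ 2 * M := Finset.sum_abs_le_of_forall_subset fun T hT => by
    rw [← Complex.re_sum]
    exact (Complex.abs_re_le_norm _).trans (h T hT)
  have h2 : ∑ i ∈ S, |(z i).im| ≤ 2 * M := Finset.sum_abs_le_of_forall_subset fun T hT => by
    rw [← Complex.im_sum]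
    exact (Complex.abs_im_le_norm _).trans (h T hT)
  have h3 : ∑ i ∈ S, ‖z i‖ ≤ ∑ i ∈ S, (|(z i).re| + |(z i).im|) :=
    Finset.sum_le_sum fun i _ => Complex.norm_le_abs_re_add_abs_im _
  rw [Finset.sum_add_distrib] at h3
  linarith

/-- Duality reduces this to scalars, where subset sums control the sum of absolute values: the
factor 4 comes from real and imaginary parts, each split by sign. -/
theorem norm_sum_smul_le_of_forall_subset {ι X : Type*} [NormedAddCommGroup X] [NormedSpace ℂ X]
    {S : Finset ι} {x : ι → X} {M K : ℝ} (hM : 0 ≤ M) (hK : 0 ≤ K)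
    (h : ∀ T ⊆ S, ‖∑ i ∈ T, x i‖ ≤ M) {m : ι → ℂ} (hm : ∀ i, ‖m i‖ ≤ K) :
    ‖∑ i ∈ S, m i • x i‖ ≤ 4 * M * K := by
  refine NormedSpace.norm_le_dual_bound ℂ _ (by positivity) fun φ => ?_
  rw [map_sum]
  have h1 : ∑ i ∈ S, ‖φ (x i)‖ ≤ 4 * (M * ‖φ‖) :=
    Finset.sum_norm_le_of_forall_subset fun T hT => by
      rw [← map_sum, mul_comm]
      exact (φ.le_opNorm _).trans (by gcongr; exact h T hT)
  calc ‖∑ i ∈ S, φ (m i • x i)‖ ≤ ∑ i ∈ S, ‖φ (m i • x i)‖ := norm_sum_le _ _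
    _ ≤ ∑ i ∈ S, K * ‖φ (x i)‖ := Finset.sum_le_sum fun i _ => by
        rw [map_smul, norm_smul]
        gcongr
        exact hm i
    _ = K * ∑ i ∈ S, ‖φ (x i)‖ := by rw [Finset.mul_sum]
    _ ≤ K * (4 * (M * ‖φ‖)) := by gcongr
    _ = 4 * M * K * ‖φ‖ := by ring

theorem IsUnconditionalSchauderFrame.exists_multiplier_bound {ι X : Type*} [NormedAddCommGroup X]
    [NormedSpace ℂ X] [CompleteSpace X] {u : ι → X} {u' : ι → StrongDual ℂ X}
    (h : IsUnconditionalSchauderFrame u u') :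
    ∃ C : ℝ, 0 ≤ C ∧ ∀ (K : ℝ) (m : ι → ℂ), 0 ≤ K → (∀ i, ‖m i‖ ≤ K) →
      ∀ (x : X) (S : Finset ι), ‖∑ i ∈ S, m i • u' i x • u i‖ ≤ C * K * ‖x‖ := by
  let P : Finset ι → X →L[ℂ] X := fun S => ∑ i ∈ S, (u' i).smulRight (u i)
  have hP : ∀ S x, P S x = ∑ i ∈ S, u' i x • u i := fun S x => by
    simp [P]
  -- Uniform boundedness over all finite index sets, not only initial segments; this is where
  -- unconditionality enters.
  obtain ⟨C, hC⟩ := banach_steinhaus (g := P) fun x => by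
    simpa only [hP] using (h x).summable.exists_norm_sum_le
  have hC0 : 0 ≤ C := (norm_nonneg _).trans (hC ∅)
  refine ⟨4 * C, by positivity, fun K m hK hm x S => ?_⟩
  have := norm_sum_smul_le_of_forall_subset (S := S) (x := fun i => u' i x • u i)
    (M := C * ‖x‖) (by positivity) hK
    (fun T _ => by
      rw [← hP]
      exact (P T).le_of_opNorm_le (hC T) x) hm
  linarith

/-- Rudin–Shapiro polynomials. -/
theorem exists_rudinShapiro (n : ℕ) : ∃ a b : ℕ → ℂ, (∀ j, a j = 1 ∨ a j = -1) ∧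
    (∀ j, b j = 1 ∨ b j = -1) ∧ ∀ z : ℂ, ‖z‖ = 1 →
      ‖∑ j ∈ Finset.range (2 ^ n), a j * z ^ j‖ ^ 2 +
        ‖∑ j ∈ Finset.range (2 ^ n), b j * z ^ j‖ ^ 2 = 2 * 2 ^ n := by
  induction n with
  | zero => exact ⟨1, 1, by simp, by simp, fun z _ => by norm_num⟩
  | succ n ih =>
    obtain ⟨a, b, ha, hb, h⟩ := ih
    -- The recursion `P ± z ^ (2 ^ n) Q`; the parallelogram law doubles the sum of squares.
    refine ⟨fun j => if j < 2 ^ n then a j else b (j - 2 ^ n),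
      fun j => if j < 2 ^ n then a j else -b (j - 2 ^ n), fun j => ?_, fun j => ?_, fun z hz => ?_⟩
    · dsimp only
      split_ifs
      exacts [ha j, hb _]
    · dsimp only
      split_ifs
      exacts [ha j, by simpa [neg_eq_iff_eq_neg, or_comm] using hb (j - 2 ^ n)]
    · have key : ∀ c : ℕ → ℂ, ∑ j ∈ Finset.range (2 ^ (n + 1)),
          (if j < 2 ^ n then a j else c (j - 2 ^ n)) * z ^ j =
          ∑ j ∈ Finset.range (2 ^ n), a j * z ^ j +
            z ^ 2 ^ n * ∑ j ∈ Finset.range (2 ^ n), c j * z ^ j := fun c => by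
        rw [pow_succ, mul_two, Finset.sum_range_add, Finset.mul_sum]
        congr 1
        · exact Finset.sum_congr rfl fun j hj => by rw [if_pos (Finset.mem_range.1 hj)]
        · refine Finset.sum_congr rfl fun j _ => ?_
          rw [if_neg (by omega), Nat.add_sub_cancel_left, pow_add]
          ring
      rw [key b, key fun j => -b j]
      simp only [neg_mul, Finset.sum_neg_distrib, mul_neg, ← sub_eq_add_neg]
      have := parallelogram_law_with_norm ℝ (∑ j ∈ Finset.range (2 ^ n), a j * z ^ j)
        (z ^ 2 ^ n * ∑ j ∈ Finset.range (2 ^ n), b j * z ^ j)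
      rw [norm_mul, norm_pow, hz, one_pow, one_mul] at this
      have hz' := h z hz
      rw [pow_succ (2 : ℝ)]
      linarith

/-! ### Disjoint translates inside a set of positive measure. -/

/-- Translation is continuous in measure, so for small `v ≠ 0` the points of `Ω` that some shift `i
v` moves out of `Ω` do not exhaust its measure. Intersecting the rest with a small ball makes the
translates disjoint. -/
theorem exists_disjoint_translates {E : Type*} [NormedAddCommGroup E] [NormedSpace ℝ E]
    [FiniteDimensional ℝ E] [Nontrivial E] [MeasurableSpace E] [BorelSpace E] (μ : Measure E)
    [μ.IsAddHaarMeasure] {Ω : Set E} (hΩ : MeasurableSet Ω) (h0 : μ Ω ≠ 0) (hfin : μ Ω ≠ ∞)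
    (N : ℕ) : ∃ (v : E) (D : Set E), MeasurableSet D ∧ μ D ≠ 0 ∧
      (∀ i : ℤ, |i| ≤ N → ∀ x ∈ D, x + (i : ℝ) • v ∈ Ω) ∧
      ∀ i : ℤ, i ≠ 0 → ∀ x ∈ D, x + (i : ℝ) • v ∉ D := by
  let T : ℤ → E → C(E, E) := fun i v => ⟨fun x => x + (i : ℝ) • v, by fun_prop⟩
  have hT : ∀ i, Tendsto (fun v => μ (symmDiff (T i v ⁻¹' Ω) (T i 0 ⁻¹' Ω))) (𝓝 0) (𝓝 0) :=
    fun i => by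
      refine tendsto_measure_symmDiff_preimage_nhds_zero (ν := μ) ?_
        (Eventually.of_forall fun v => measurePreserving_add_right μ _)
        (measurePreserving_add_right μ _) hΩ.nullMeasurableSet hfin
      refine (ContinuousMap.continuous_of_continuous_uncurry (T i) ?_).tendsto 0
      exact continuous_snd.add (continuous_fst.const_smul (i : ℝ))
  have hsum := tendsto_finsetSum (Finset.Icc (-(N : ℤ)) N) fun i _ => hT i
  rw [Finset.sum_const_zero] at hsum
  have hev := (hsum.mono_left (nhdsWithin_le_nhds (s := {(0 : E)}ᶜ))).eventually_lt_const (pos_iff_ne_zero.2 h0)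
  have := Module.punctured_nhds_neBot ℝ E 0
  obtain ⟨v, hv, hv0⟩ := (hev.and (self_mem_nhdsWithin (s := {(0 : E)}ᶜ))).exists
  let A : Set E := ⋂ i ∈ Finset.Icc (-(N : ℤ)) N, T i v ⁻¹' Ω
  have hA : MeasurableSet A := Finset.measurableSet_biInter _ fun i _ =>
    (T i v).continuous.measurable hΩ
  have hA0 : μ A ≠ 0 := fun hA0 => by
    have hsub : Ω ⊆ A ∪ ⋃ i ∈ Finset.Icc (-(N : ℤ)) N,
        symmDiff (T i v ⁻¹' Ω) (T i 0 ⁻¹' Ω) := fun x hx => by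
      by_cases hxA : x ∈ A
      · exact Or.inl hxA
      · right
        simp only [A, Set.mem_iInter, not_forall] at hxA
        obtain ⟨i, hi, hxi⟩ := hxA
        exact Set.mem_biUnion hi (Or.inr ⟨by simpa [T] using hx, hxi⟩)
    have := (measure_mono (μ := μ) hsub).trans (measure_union_le _ _)
    rw [hA0, zero_add] at this
    exact (this.trans (measure_biUnion_finset_le _ _)).not_gt hv
  -- Two points of a ball of radius `‖v‖ / 2` are less than `‖v‖` apart, so they cannot differ by a
  -- nonzero integer multiple of `v`.
  have hx : ∃ x ∈ A, μ (A ∩ Metric.ball x (‖v‖ / 2)) ≠ 0 := by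
    by_contra! hcon
    exact hA0 (measure_null_of_locally_null A fun x hx => ⟨_,
      inter_mem_nhdsWithin _ (Metric.ball_mem_nhds x (half_pos (norm_pos_iff.2 hv0))), hcon x hx⟩)
  obtain ⟨x₀, -, hx₀⟩ := hx
  refine ⟨v, A ∩ Metric.ball x₀ (‖v‖ / 2), hA.inter Metric.isOpen_ball.measurableSet, hx₀,
    fun i hi x hx => ?_, fun i hi x hx hx' => ?_⟩
  · have := hx.1
    simp only [A, Set.mem_iInter, Finset.mem_Icc] at this
    exact this i (abs_le.1 hi)
  · have h1 := Metric.mem_ball.1 hx.2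
    have h2 := Metric.mem_ball.1 hx'.2
    have h3 := dist_triangle_right (x + (i : ℝ) • v) x x₀
    rw [dist_self_add_left, norm_smul, Real.norm_eq_abs] at h3
    have h4 : (1 : ℝ) ≤ |(i : ℝ)| := by exact_mod_cast Int.one_le_abs hi
    nlinarith [norm_nonneg v]

/-! ### Sums of translates in `L^p` and the bound forced by a frame. -/

theorem eLpNorm_comp_sub_restrict_le {E F : Type*} [NormedAddCommGroup E] [MeasurableSpace E]
    [BorelSpace E] [NormedAddCommGroup F] (μ : Measure E) [μ.IsAddRightInvariant] {D Ω : Set E}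
    {w : E} (hD : ∀ x ∈ D, x - w ∈ Ω) {g : E → F} (hg : AEStronglyMeasurable g (μ.restrict Ω))
    (p : ℝ≥0∞) :
    eLpNorm (fun x => g (x - w)) p (μ.restrict D) ≤ eLpNorm g p (μ.restrict Ω) := by
  have hmp := (measurePreserving_sub_right μ w).restrict_preimage_emb
    (MeasurableEquiv.subRight w).measurableEmbedding Ω
  rw [← eLpNorm_comp_measurePreserving hg hmp]
  exact eLpNorm_mono_measure _ (Measure.restrict_mono_set μ hD)

theorem eLpNorm_sum_translate_le_add {E : Type*} [NormedAddCommGroup E] [NormedSpace ℝ E]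
    [MeasurableSpace E] [BorelSpace E] (μ : Measure E) [μ.IsAddRightInvariant] {p : ℝ≥0∞}
    (hp : 1 ≤ p) {F f : E → ℂ} (hF : Measurable F) (hf : Measurable f) {N : ℕ} {D Ω : Set E} {v : E}
    (hD : ∀ j < N, ∀ x ∈ D, x - (j : ℝ) • v ∈ Ω) (a : ℕ → ℂ) :
    eLpNorm (fun x => ∑ j ∈ Finset.range N, a j * f (x - (j : ℝ) • v)) p (μ.restrict D) ≤
      eLpNorm (fun x => ∑ j ∈ Finset.range N, a j * F (x - (j : ℝ) • v)) p (μ.restrict D) +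
        ∑ j ∈ Finset.range N, ‖a j‖ₑ * eLpNorm (F - f) p (μ.restrict Ω) := by
  have hterm : ∀ {g : E → ℂ}, Measurable g → ∀ j : ℕ, Measurable fun x => g (x - (j : ℝ) • v) :=
    fun hg j => hg.comp (measurable_sub_const _)
  have hsplit : (fun x => ∑ j ∈ Finset.range N, a j * f (x - (j : ℝ) • v)) =
      (fun x => ∑ j ∈ Finset.range N, a j * F (x - (j : ℝ) • v)) -
        ∑ j ∈ Finset.range N, a j • fun x => (F - f) (x - (j : ℝ) • v) := by
    ext x
    simp only [Pi.sub_apply, Finset.sum_apply, Pi.smul_apply, smul_eq_mul]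
    rw [← Finset.sum_sub_distrib]
    exact Finset.sum_congr rfl fun j _ => by ring
  rw [hsplit]
  refine (eLpNorm_sub_le (Measurable.aestronglyMeasurable ?_)
    (Measurable.aestronglyMeasurable ?_) hp).trans (add_le_add_right ?_ _)
  · exact Finset.measurable_fun_sum _ fun j _ => (hterm hF j).const_mul _
  · rw [Finset.sum_fn]
    exact Finset.measurable_fun_sum _ fun j _ => (hterm (hF.sub hf) j).const_smul (a j)
  · refine (eLpNorm_sum_le (fun j _ =>
      ((hterm (hF.sub hf) j).const_smul (a j)).aestronglyMeasurable) hp).trans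
      (Finset.sum_le_sum fun j hj => ?_)
    rw [eLpNorm_const_smul]
    gcongr
    exact eLpNorm_comp_sub_restrict_le μ (hD j (Finset.mem_range.1 hj))
      (hF.sub hf).aestronglyMeasurable p

section Exponentials

variable {d : ℕ}

theorem expFun_sub_nsmul (l x v : EuclideanSpace ℝ (Fin d)) (j : ℕ) :
    expFun l (x - (j : ℝ) • v) = expFun l (-v) ^ j * expFun l x := by
  simp only [expFun, ← Complex.exp_nat_mul, ← Complex.exp_add]
  congr 1
  rw [inner_sub_right, inner_smul_right, inner_neg_right]
  push_cast
  ring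

theorem coeFn_sum_smul_expLp {Ω : Set (EuclideanSpace ℝ (Fin d))} (hΩ : volume Ω < ∞) (p : ℝ≥0∞)
    {ι : Type*} (l : ι → EuclideanSpace ℝ (Fin d)) (c : ι → ℂ) (S : Finset ι) :
    ⇑(∑ i ∈ S, c i • expLp hΩ p (l i)) =ᵐ[volume.restrict Ω]
      fun x => ∑ i ∈ S, c i * expFun (l i) x := by
  classical
  induction S using Finset.induction_on with
  | empty => simpa using! Lp.coeFn_zero ℂ p (volume.restrict Ω)
  | insert i S hi ih =>
    rw [Finset.sum_insert hi]
    filter_upwards [Lp.coeFn_add (c i • expLp hΩ p (l i)) (∑ i ∈ S, c i • expLp hΩ p (l i)), ih,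
      Lp.coeFn_smul (c i) (expLp hΩ p (l i)), (memLp_expFun hΩ p (l i)).coeFn_toLp]
      with x h1 h2 h3 h4
    rw [h1, Pi.add_apply, h2, h3, Finset.sum_insert hi, Pi.smul_apply, smul_eq_mul]
    congr 2

/-- The finite partial sums of the frame expansion are defined on the whole space, so they can be
translated freely and obey the multiplier bound. The bound passes to `f` because each translate from
`D` only sees the approximation error on `Ω`. -/
theorem exists_eLpNorm_sum_translate_le {Ω : Set (EuclideanSpace ℝ (Fin d))} {hΩ : volume Ω < ∞}
    {p : ℝ≥0∞} [Fact (1 ≤ p)] (h : AdmitsUnconditionalExpFrame hΩ p) :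
    ∃ C : ℝ, 0 ≤ C ∧ ∀ (N : ℕ) (a : ℕ → ℂ) (K : ℝ) (v : EuclideanSpace ℝ (Fin d))
      (D : Set (EuclideanSpace ℝ (Fin d))), 0 ≤ K →
      (∀ z : ℂ, ‖z‖ = 1 → ‖∑ j ∈ Finset.range N, a j * z ^ j‖ ≤ K) → D ⊆ Ω →
      (∀ j < N, ∀ x ∈ D, x - (j : ℝ) • v ∈ Ω) →
      ∀ f : EuclideanSpace ℝ (Fin d) → ℂ, Measurable f → MemLp f p (volume.restrict Ω) →
        eLpNorm (fun x => ∑ j ∈ Finset.range N, a j * f (x - (j : ℝ) • v)) p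
          (volume.restrict D) ≤ ENNReal.ofReal (C * K) * eLpNorm f p (volume.restrict Ω) := by
  obtain ⟨Λ, -, e', he⟩ := h
  obtain ⟨C, hC0, hC⟩ := he.exists_multiplier_bound
  refine ⟨C, hC0, fun N a K v D hK ha hDΩ hD f hf hfp => ?_⟩
  have hp : 1 ≤ p := Fact.out
  let c : Λ → ℂ := fun l => e' l (hfp.toLp f)
  let m : Λ → ℂ := fun l =>
    ∑ j ∈ Finset.range N, a j * expFun (l : EuclideanSpace ℝ (Fin d)) (-v) ^ j
  let F : Finset Λ → EuclideanSpace ℝ (Fin d) → ℂ := fun S x =>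
    ∑ l ∈ S, c l * expFun (l : EuclideanSpace ℝ (Fin d)) x
  have hFc : ∀ S, Continuous (F S) := fun S =>
    continuous_finsetSum _ fun l _ => continuous_const.mul (continuous_expFun _)
  have hδ : Tendsto (fun S => eLpNorm (F S - f) p (volume.restrict Ω)) atTop (𝓝 0) := by
    have h1 := tendsto_iff_edist_tendsto_0.1 (he (hfp.toLp f))
    refine h1.congr fun S => ?_
    rw [edist_eq_enorm_sub, Lp.enorm_def]
    refine eLpNorm_congr_ae ?_
    filter_upwards [Lp.coeFn_sub (∑ l ∈ S, c l • expLp hΩ p (l : EuclideanSpace ℝ (Fin d)))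
      (hfp.toLp f), coeFn_sum_smul_expLp hΩ p (fun l : Λ => (l : EuclideanSpace ℝ (Fin d))) c S,
      hfp.coeFn_toLp] with x h1 h2 h3
    rw [h1, Pi.sub_apply, h2, h3, Pi.sub_apply]
  have hm : ∀ l, ‖m l‖ ≤ K := fun l => ha _ (norm_expFun _ _)
  -- Exponentials are eigenfunctions of translation, so the sum of translates multiplies the
  -- coefficients by `m`.
  have hG : ∀ S x, ∑ j ∈ Finset.range N, a j * F S (x - (j : ℝ) • v) =
      ∑ l ∈ S, (m l * c l) * expFun (l : EuclideanSpace ℝ (Fin d)) x := fun S x => by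
    simp only [F, m, expFun_sub_nsmul, Finset.mul_sum, Finset.sum_mul]
    rw [Finset.sum_comm]
    exact Finset.sum_congr rfl fun l _ => Finset.sum_congr rfl fun j _ => by ring
  have hGle : ∀ S, eLpNorm (fun x => ∑ j ∈ Finset.range N, a j * F S (x - (j : ℝ) • v)) p
      (volume.restrict D) ≤ ENNReal.ofReal (C * K) * eLpNorm f p (volume.restrict Ω) := fun S => by
    refine (eLpNorm_mono_measure _ (Measure.restrict_mono_set volume hDΩ)).trans ?_
    simp only [hG]
    rw [← eLpNorm_congr_ae (coeFn_sum_smul_expLp hΩ p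
      (fun l : Λ => (l : EuclideanSpace ℝ (Fin d))) (fun l => m l * c l) S), ← Lp.enorm_def,
      ← Lp.enorm_toLp hfp, ← ofReal_norm, ← ofReal_norm, ← ENNReal.ofReal_mul (by positivity)]
    refine ENNReal.ofReal_le_ofReal ?_
    simpa only [mul_smul] using hC K m hK hm (hfp.toLp f) S
  have hle := fun S => (eLpNorm_sum_translate_le_add volume hp (hFc S).measurable hf hD a).trans
    (add_le_add_left (hGle S) _)
  have hlim : Tendsto (fun S => ENNReal.ofReal (C * K) * eLpNorm f p (volume.restrict Ω) +
      ∑ j ∈ Finset.range N, ‖a j‖ₑ * eLpNorm (F S - f) p (volume.restrict Ω)) atTop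
      (𝓝 (ENNReal.ofReal (C * K) * eLpNorm f p (volume.restrict Ω) + 0)) := by
    refine tendsto_const_nhds.add ?_
    have := tendsto_finsetSum (Finset.range N) fun j _ =>
      ENNReal.Tendsto.const_mul hδ (Or.inr (enorm_ne_top (x := a j)))
    simpa using this
  rw [add_zero] at hlim
  exact ge_of_tendsto' hlim hle

end Exponentials

/-! ### Growth rates and the two test functions. -/

theorem false_of_forall_two_pow_rpow_le {s C : ℝ} (hs : 1 / 2 < s)
    (h : ∀ n : ℕ, ((2 : ℝ) ^ n) ^ s ≤ C * √(2 * 2 ^ n)) : False := by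
  obtain ⟨n, hn⟩ := pow_unbounded_of_one_lt (C * √2)
    (Real.one_lt_rpow one_lt_two (sub_pos.2 hs))
  have h1 := h n
  have hpos : (0 : ℝ) < √(2 ^ n) := by positivity
  have h2 : ((2 : ℝ) ^ n) ^ s = ((2 : ℝ) ^ (s - 1 / 2)) ^ n * √(2 ^ n) := by
    rw [Real.sqrt_eq_rpow, ← Real.rpow_natCast, ← Real.rpow_natCast, ← Real.rpow_mul two_pos.le,
      ← Real.rpow_mul two_pos.le, ← Real.rpow_mul two_pos.le, ← Real.rpow_add two_pos]
    ring_nf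
  rw [h2, Real.sqrt_mul two_pos.le, ← mul_assoc] at h1
  exact (le_of_mul_le_mul_right h1 hpos).not_gt hn

theorem exists_signs_norm_sum_le (n : ℕ) : ∃ a : ℕ → ℂ, (∀ j, a j = 1 ∨ a j = -1) ∧
    ∀ z : ℂ, ‖z‖ = 1 → ‖∑ j ∈ Finset.range (2 ^ n), a j * z ^ j‖ ≤ √(2 * 2 ^ n) := by
  obtain ⟨a, b, ha, -, h⟩ := exists_rudinShapiro n
  refine ⟨a, ha, fun z hz => Real.le_sqrt_of_sq_le ?_⟩
  rw [← h z hz]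
  exact le_add_of_nonneg_right (sq_nonneg _)

section Translates

variable {E : Type*} [AddCommGroup E] [Module ℝ E] {D : Set E} {v : E}

theorem sub_nsmul_notMem (hD : ∀ i : ℤ, i ≠ 0 → ∀ x ∈ D, x + (i : ℝ) • v ∉ D) {j k : ℕ}
    (hjk : j ≠ k) {x : E} (hx : x - (k : ℝ) • v ∈ D) : x - (j : ℝ) • v ∉ D := by
  have := hD ((k : ℤ) - j) (by omega) _ hx
  convert this using 2
  push_cast
  module

theorem sub_nsmul_mem {Ω : Set E} {N : ℕ}
    (hD : ∀ i : ℤ, |i| ≤ N → ∀ x ∈ D, x + (i : ℝ) • v ∈ Ω) {j k : ℕ} (hj : j < N) (hk : k < N)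
    {x : E} (hx : x - (k : ℝ) • v ∈ D) : x - (j : ℝ) • v ∈ Ω := by
  have := hD ((k : ℤ) - j) (by rw [abs_le]; omega) _ hx
  convert this using 1
  push_cast
  module

theorem sum_mul_indicator_sub_nsmul (hD : ∀ i : ℤ, i ≠ 0 → ∀ x ∈ D, x + (i : ℝ) • v ∉ D)
    (a : ℕ → ℂ) {N k : ℕ} (hk : k < N) {x : E} (hx : x - (k : ℝ) • v ∈ D) :
    ∑ j ∈ Finset.range N, a j * D.indicator 1 (x - (j : ℝ) • v) = a k := by
  rw [Finset.sum_eq_single k]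
  · simp [Set.indicator_of_mem hx]
  · intro j _ hj
    rw [Set.indicator_of_notMem (sub_nsmul_notMem hD hj hx), mul_zero]
  · exact fun h => absurd (Finset.mem_range.2 hk) h

end Translates

section

variable {d : ℕ} {Ω : Set (EuclideanSpace ℝ (Fin d))}

theorem exists_disjoint_translates_nullMeasurable (hd : 1 ≤ d) (hmeas : NullMeasurableSet Ω volume)
    (hpos : 0 < volume Ω) (hfin : volume Ω < ∞) (N : ℕ) :
    ∃ (v : EuclideanSpace ℝ (Fin d)) (D : Set (EuclideanSpace ℝ (Fin d))), MeasurableSet D ∧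
      volume D ≠ 0 ∧ volume D ≠ ∞ ∧ D ⊆ Ω ∧
      (∀ i : ℤ, |i| ≤ N → ∀ x ∈ D, x + (i : ℝ) • v ∈ Ω) ∧
      ∀ i : ℤ, i ≠ 0 → ∀ x ∈ D, x + (i : ℝ) • v ∉ D := by
  have : Nonempty (Fin d) := ⟨⟨0, hd⟩⟩
  -- A measurable subset, rather than an a.e. equal set, keeps the inclusions in `Ω` pointwise.
  obtain ⟨Ω', hsub, hm, hae⟩ := hmeas.exists_measurable_subset_ae_eq
  have hvol : volume Ω' = volume Ω := measure_congr hae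
  obtain ⟨v, D, hDm, hD0, hDΩ, hDD⟩ := exists_disjoint_translates volume hm
    (hvol ▸ hpos.ne') (hvol ▸ hfin.ne) N
  have hD : D ⊆ Ω := fun x hx => by simpa using hsub (hDΩ 0 (by simp) x hx)
  exact ⟨v, D, hDm, hD0, ((measure_mono hD).trans_lt hfin).ne, hD,
    fun i hi x hx => hsub (hDΩ i hi x hx), hDD⟩

theorem two_pow_rpow_le_of_eLpNorm_bound (hd : 1 ≤ d) (hmeas : NullMeasurableSet Ω volume)
    (hpos : 0 < volume Ω) (hfin : volume Ω < ∞) {p : ℝ≥0∞} [Fact (1 ≤ p)] (hp : p ≠ ∞)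
    (h : AdmitsUnconditionalExpFrame hfin p) : ∃ C : ℝ, 0 ≤ C ∧ ∀ n : ℕ,
      ((2 : ℝ) ^ n) ^ (1 / p.toReal) ≤ C * √(2 * 2 ^ n) ∧
      ((2 : ℝ) ^ n) ^ (1 - 1 / p.toReal) ≤ C * √(2 * 2 ^ n) := by
  obtain ⟨C, hC0, hC⟩ := exists_eLpNorm_sum_translate_le h
  have hp0 : p ≠ 0 := (one_pos.trans_le (Fact.out : 1 ≤ p)).ne'
  have hq : 0 < p.toReal := ENNReal.toReal_pos hp0 hp
  have hq' : 0 ≤ 1 / p.toReal := by positivity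
  have : IsFiniteMeasure (volume.restrict Ω) := ⟨by simpa using hfin⟩
  refine ⟨C, hC0, fun n => ?_⟩
  obtain ⟨a, ha, hak⟩ := exists_signs_norm_sum_le n
  have han : ∀ j, ‖a j‖ = 1 := fun j => by rcases ha j with h | h <;> simp [h]
  have haa : ∀ j, a j * a j = 1 := fun j => by rcases ha j with h | h <;> simp [h]
  obtain ⟨v, D, hDm, hD0, hDtop, hDΩ, hDt, hDD⟩ :=
    exists_disjoint_translates_nullMeasurable hd hmeas hpos hfin (2 ^ n)
  have hδ0 : volume D ^ (1 / p.toReal) ≠ 0 := by simp [ENNReal.rpow_eq_zero_iff, hD0, hDtop]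
  have hδt : volume D ^ (1 / p.toReal) ≠ ∞ := ENNReal.rpow_ne_top_of_nonneg hq' hDtop
  have hpre : ∀ w, volume ((fun x => x - w) ⁻¹' D) = volume D := fun w =>
    (measurePreserving_sub_right volume w).measure_preimage hDm.nullMeasurableSet
  have hpre' : ∀ w, volume ((fun x => x + w) ⁻¹' D) = volume D := fun w =>
    (measurePreserving_add_right volume w).measure_preimage hDm.nullMeasurableSet
  have hN : ENNReal.ofReal (2 ^ n) = ((2 ^ n : ℕ) : ℝ≥0∞) := by
    rw [← ENNReal.ofReal_natCast]; push_cast; rfl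
  have hNr : ENNReal.ofReal (((2 : ℝ) ^ n) ^ (1 / p.toReal)) =
      ((2 ^ n : ℕ) : ℝ≥0∞) ^ (1 / p.toReal) := by
    rw [← hN, ENNReal.ofReal_rpow_of_pos (by positivity)]
  have hNpos : (0 : ℝ) < (2 ^ n) ^ (1 / p.toReal) := by positivity
  constructor
  -- Spreading: the translates of the indicator of `D` sum to a function of modulus 1 on `D'`, which
  -- has measure `2 ^ n` times that of `D`.
  · let D' := ⋃ k ∈ Finset.range (2 ^ n), (fun x => x - (k : ℝ) • v) ⁻¹' D
    have hmem : ∀ x ∈ D', ∃ k : ℕ, k < 2 ^ n ∧ x - (k : ℝ) • v ∈ D := fun x hx => by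
      simpa [D'] using hx
    have hD'm : MeasurableSet D' := Finset.measurableSet_biUnion _ fun k _ =>
      measurable_sub_const _ hDm
    have hD'vol : volume D' = ((2 ^ n : ℕ) : ℝ≥0∞) * volume D := by
      rw [measure_biUnion_finset _ fun k _ => measurable_sub_const _ hDm]
      · simp [hpre]
      · exact fun j _ k _ hjk => Set.disjoint_left.2 fun x hj hk => sub_nsmul_notMem hDD hjk hk hj
    have hfm : Measurable (D.indicator (1 : EuclideanSpace ℝ (Fin d) → ℂ)) :=
      measurable_one.indicator hDm
    have key := hC (2 ^ n) a _ v D' (Real.sqrt_nonneg _) hak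
      (fun x hx => by
        obtain ⟨k, hk, hxk⟩ := hmem x hx
        simpa using sub_nsmul_mem hDt (j := 0) (by positivity) hk hxk)
      (fun j hj x hx => by
        obtain ⟨k, hk, hxk⟩ := hmem x hx
        exact sub_nsmul_mem hDt hj hk hxk)
      (D.indicator 1) hfm
      (MemLp.of_bound hfm.aestronglyMeasurable 1 (Eventually.of_forall fun x =>
        (norm_indicator_le_norm_self _ _).trans (by simp)))
    have hleft : eLpNorm (fun x => ∑ j ∈ Finset.range (2 ^ n),
        a j * D.indicator 1 (x - (j : ℝ) • v)) p (volume.restrict D') =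
        (((2 ^ n : ℕ) : ℝ≥0∞) * volume D) ^ (1 / p.toReal) := by
      rw [eLpNorm_congr_norm_ae (g := fun _ => (1 : ℂ)), eLpNorm_const' _ hp0 hp]
      · simp [hD'vol]
      · filter_upwards [ae_restrict_mem hD'm] with x hx
        obtain ⟨k, hk, hxk⟩ := hmem x hx
        rw [sum_mul_indicator_sub_nsmul hDD a hk hxk, han, norm_one]
    have hright : eLpNorm (D.indicator (1 : EuclideanSpace ℝ (Fin d) → ℂ)) p (volume.restrict Ω) ≤
        volume D ^ (1 / p.toReal) := by
      refine (eLpNorm_mono_measure _ Measure.restrict_le_self).trans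
        ((eLpNorm_indicator_const_le (1 : ℂ) p).trans ?_)
      simp
    rw [hleft, ENNReal.mul_rpow_of_nonneg _ _ hq'] at key
    have := (ENNReal.mul_le_mul_iff_left hδ0 hδt).1 (key.trans (mul_le_mul_right hright _))
    rw [← hNr] at this
    exact (ENNReal.ofReal_le_ofReal_iff (by positivity)).1 this
  -- Stacking: `f` takes the sign `a k` on `D - k v`, so on `D` each term of the translated sum is
  -- `a k * a k = 1` and the total is `2 ^ n`, while `f` has modulus at most 1 and vanishes off `U`.
  · let U := ⋃ k ∈ Finset.range (2 ^ n), (fun x => x + (k : ℝ) • v) ⁻¹' D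
    have hUvol : volume U ≤ ((2 ^ n : ℕ) : ℝ≥0∞) * volume D := by
      refine (measure_biUnion_finset_le _ _).trans ?_
      simp [hpre']
    let f : EuclideanSpace ℝ (Fin d) → ℂ := fun x =>
      ∑ k ∈ Finset.range (2 ^ n), a k * D.indicator 1 (x + (k : ℝ) • v)
    have hfm : Measurable f := Finset.measurable_fun_sum _ fun k _ =>
      ((measurable_one.indicator hDm).comp (measurable_add_const _)).const_mul _
    have hDD' : ∀ i : ℤ, i ≠ 0 → ∀ x ∈ D, x + (i : ℝ) • -v ∉ D := fun i hi x hx => by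
      simpa using hDD (-i) (neg_ne_zero.2 hi) x hx
    have hfa : ∀ k : ℕ, k < 2 ^ n → ∀ x, x + (k : ℝ) • v ∈ D → f x = a k := fun k hk x hx => by
      have := sum_mul_indicator_sub_nsmul hDD' a hk (x := x) (by simpa using hx)
      simpa [f] using this
    have hf0 : ∀ x ∉ U, f x = 0 := fun x hx => Finset.sum_eq_zero fun k hk => by
      rw [Set.indicator_of_notMem, mul_zero]
      exact fun hxk => hx (Set.mem_biUnion hk hxk)
    have hfU : ∀ x, ‖f x‖ ≤ ‖U.indicator (fun _ => (1 : ℂ)) x‖ := fun x => by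
      by_cases hx : x ∈ U
      · obtain ⟨k, hk, hxk⟩ : ∃ k : ℕ, k < 2 ^ n ∧ x + (k : ℝ) • v ∈ D := by simpa [U] using hx
        rw [hfa k hk x hxk, han, Set.indicator_of_mem hx, norm_one]
      · rw [hf0 x hx, norm_zero]
        exact norm_nonneg _
    have key := hC (2 ^ n) a _ v D (Real.sqrt_nonneg _) hak hDΩ
      (fun j hj x hx => sub_nsmul_mem hDt hj (k := 0) (by positivity) (by simpa using hx)) f hfm
      (MemLp.of_bound hfm.aestronglyMeasurable 1 (Eventually.of_forall fun x =>
        (hfU x).trans ((norm_indicator_le_norm_self _ _).trans (by simp))))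
    have hleft : eLpNorm (fun x => ∑ j ∈ Finset.range (2 ^ n), a j * f (x - (j : ℝ) • v)) p
        (volume.restrict D) = ((2 ^ n : ℕ) : ℝ≥0∞) * volume D ^ (1 / p.toReal) := by
      rw [eLpNorm_congr_ae (g := fun _ => ((2 ^ n : ℕ) : ℂ)), eLpNorm_const' _ hp0 hp]
      · rw [Measure.restrict_apply_univ, ← ofReal_norm, Complex.norm_natCast, ENNReal.ofReal_natCast]
      · filter_upwards [ae_restrict_mem hDm] with x hx
        have h1 : ∀ j ∈ Finset.range (2 ^ n), a j * f (x - (j : ℝ) • v) = 1 := fun j hj => by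
          rw [hfa j (Finset.mem_range.1 hj) _ (by simpa using hx), haa]
        rw [Finset.sum_congr rfl h1]
        simp
    have hright : eLpNorm f p (volume.restrict Ω) ≤
        ((2 ^ n : ℕ) : ℝ≥0∞) ^ (1 / p.toReal) * volume D ^ (1 / p.toReal) := by
      refine (eLpNorm_mono hfU).trans ((eLpNorm_mono_measure _ Measure.restrict_le_self).trans
        ((eLpNorm_indicator_const_le (1 : ℂ) p).trans ?_))
      rw [enorm_one, one_mul, ← ENNReal.mul_rpow_of_nonneg _ _ hq']
      gcongr
    rw [hleft] at key
    have := key.trans (mul_le_mul_right hright _)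
    rw [← mul_assoc] at this
    have := (ENNReal.mul_le_mul_iff_left hδ0 hδt).1 this
    rw [← hNr, ← hN, ← ENNReal.ofReal_mul (by positivity),
      ENNReal.ofReal_le_ofReal_iff (by positivity)] at this
    rw [Real.rpow_sub (by positivity), Real.rpow_one, div_le_iff₀ hNpos]
    exact this

end

theorem theorem1p2 {d : ℕ} (hd : 1 ≤ d) {Ω : Set (EuclideanSpace ℝ (Fin d))}
    (hmeas : NullMeasurableSet Ω volume) (hpos : 0 < volume Ω) (hfin : volume Ω < ∞)
    (p : ℝ≥0∞) [Fact (1 ≤ p)] :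
    (1 < p → p < 2 → ¬ AdmitsUnconditionalExpFrame hfin p) ∧
    (2 < p → p < ∞ → (interior Ω).Nonempty → ¬ AdmitsUnconditionalExpFrame hfin p) := by
  have hp0 : p ≠ 0 := (one_pos.trans_le (Fact.out : 1 ≤ p)).ne'
  refine ⟨fun _ hp2 h => ?_, fun hp2 hp _ h => ?_⟩
  · have hp : p ≠ ∞ := (hp2.trans (by simp)).ne
    obtain ⟨C, -, hC⟩ := two_pow_rpow_le_of_eLpNorm_bound hd hmeas hpos hfin hp h
    refine false_of_forall_two_pow_rpow_le ?_ fun n => (hC n).1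
    exact one_div_lt_one_div_of_lt (ENNReal.toReal_pos hp0 hp)
      (by simpa using (ENNReal.toReal_lt_toReal hp (by simp)).2 hp2)
  · obtain ⟨C, -, hC⟩ := two_pow_rpow_le_of_eLpNorm_bound hd hmeas hpos hfin hp.ne h
    refine false_of_forall_two_pow_rpow_le ?_ fun n => (hC n).2
    have : 1 / p.toReal < 1 / 2 := one_div_lt_one_div_of_lt two_pos
      (by simpa using (ENNReal.toReal_lt_toReal (by simp) hp.ne).2 hp2)
    linarith
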